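/- Let $(\Omega,\mathcal F,\mathbb P)$ be a probability space, $\mathcal F_T\subseteq\mathcal F$ a sub-$\sigma$-algebra (measurability with respect to $\mathcal F_T$ is understood up to null sets), $\varsigma_T\ge 0$ an integrable $\mathcal F_T$-measurable random variable (the stochastic discount factor), and $X_T^\delta\in L^2(\mathbb P)$ an $\mathcal F_T$-measurable random variable (the benchmark's terminal wealth) with continuous distribution function $F$, such that $\varsigma_TX_T^\delta$ is integrable. Write $F_Y^{-1}(u)=\inf\{y: F_Y(y)\ge u\}$, $u\in(0,1)$, for the quantile function of a random variable $Y$, $F^{-1}=F^{-1}_{X_T^\delta}$, and put $U^\delta=F(X_T^\delta)$, $X_0^\delta=\mathbb E[\varsigma_TX_T^\delta]$. Assume that almost surely the conditional distribution function $F_{\varsigma_T|U^\delta}(\cdot\,|\,U^\delta)$ is continuous. Let $C$ be a bivariate copula, let $C(\cdot\,|\,v)$ be the conditional distribution function of its first coordinate given that the second equals $v$, with left-inverse $C^{-1}(x\,|\,v)=\inf\{u: C(u\,|\,v)\ge x\}$, and let $$V=C^{-1}\bigl(1-F_{\varsigma_T|U^\delta}(\varsigma_T\,|\,U^\delta)\,\big|\,U^\delta\bigr),\qquad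 \xi(u)=\mathbb E[\varsigma_T\,|\,V=u].$$ Let $\gamma\in L^2(0,1)$ with $\gamma\ge 0$ and $\int_0^1\gamma=1$, and put $\mathcal R(g)=-\int_0^1 g(u)\gamma(u)\,du$ for a function $g \in L^2(0,1)$ and $\mathcal R[X]=\mathcal R(F_X^{-1})$ for a random variable $X\in L^2(\mathbb P)$. Let $\varepsilon\ge 0$, and let $d_2$ be the 2-Wasserstein distance (the infimum over couplings). Consider the problems $(P')$: minimise $\mathcal R[X]$ over the $\mathcal F_T$-measurable $X\in L^2(\mathbb P)$ such that $(X,X_T^\delta)$ has copula $C$, i.e. $\mathbb P(X\le x,X_T^\delta\le y)=C(F_X(x),F(y))$ for all $x,y$, and such that $d_2[X,X_T^\delta]\le\varepsilon$ and $\mathbb E[\varsigma_TX]\le X_0^\delta$; $(\breve P')$: minimise $\mathcal R(g)$ over the non-decreasing, left-continuous $g\in L^2(0,1)$ such that $\int_0^1(g(u)-F^{-1}(u))^2\,du\le\varepsilon^2$ and $\int_0^1 g(u)\,\xi(u)\,du\le X_0^\delta$. (In the two budget constraints the integral is understood in $[-\infty,\infty)$, i.e. its positive part must be finite; this is automatic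 if $\varsigma_T\in L^2(\mathbb P)$.) The two problems are equivalent in the following sense: (i) if $g^*$ attains the infimum in $(\breve P')$, then $X^*=g^*(V)$ is admissible for $(P')$ and attains its infimum; (ii) if $X^*$ attains the infimum in $(P')$, then its quantile function $F_{X^*}^{-1}$ is admissible for $(\breve P')$ and attains its infimum. -/

import Mathlib

open MeasureTheory ProbabilityTheory Set
open scoped ENNReal

noncomputable section

namespace Portfolio

/-- The uniform distribution on the open unit interval. -/
def unif : Measure ℝ := volume.restrict (Ioo 0 1)

/-- The left-inverse (quantile function) of the distribution function of a law `μ` on `ℝ`,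
`u ↦ inf {y | F(y) ≥ u}`. It is only used for levels `u` in `(0,1)`, where the set is nonempty and
bounded below. -/
def quantile (μ : Measure ℝ) (u : ℝ) : ℝ := sInf {y : ℝ | u ≤ cdf μ y}

/-- A bivariate copula: a probability distribution on the plane with uniform marginals. -/
structure Copula where
  /-- the joint law -/
  law : Measure (ℝ × ℝ)
  isProb : IsProbabilityMeasure law
  map_fst : law.map Prod.fst = unif
  map_snd : law.map Prod.snd = unif

instance (C : Copula) : IsProbabilityMeasure C.law := C.isProb

/-- The distribution function `C(u, v)` of a copula. -/
def Copula.df (C : Copula) (u v : ℝ) : ℝ := C.law.real (Iic u ×ˢ Iic v)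

/-- The conditional copula: the regular conditional law of the first coordinate given that the
second one equals `v`. Its distribution function is `u ↦ C(u | v)`. -/
def Copula.cond (C : Copula) (v : ℝ) : Measure ℝ := condDistrib Prod.fst Prod.snd C.law v

/-- The inverse of the conditional copula, `x ↦ inf {u | C(u | v) ≥ x}`. -/
def Copula.condInv (C : Copula) (x v : ℝ) : ℝ := quantile (C.cond v) x

/-- The law on `ℝ²` of two real random variables `X`, `Y` has copula `C`:
`P(X ≤ x, Y ≤ y) = C(F_X(x), F_Y(y))` for all `x`, `y`. -/
def HasCopula {Ω : Type*} [MeasurableSpace Ω] (P : Measure Ω) (X Y : Ω → ℝ) (C : Copula) : Prop :=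
  ∀ x y : ℝ, P.real {ω | X ω ≤ x ∧ Y ω ≤ y} = C.df (cdf (P.map X) x) (cdf (P.map Y) y)

/-- The 2-Wasserstein distance of two laws on the line, an infimum over couplings. -/
def wasserstein (μ ν : Measure ℝ) : ℝ≥0∞ :=
  ⨅ χ ∈ {χ : Measure (ℝ × ℝ) | χ.map Prod.fst = μ ∧ χ.map Prod.snd = ν},
    (∫⁻ p, ENNReal.ofReal (|p.1 - p.2| ^ 2) ∂χ) ^ (1 / 2 : ℝ)

/-- `∫ f dμ ≤ b`, where the integral takes values in `[-∞, ∞)`: the positive part of `f` must have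
finite integral, and the integral is that of the positive part minus that of the negative part.
For integrable `f` this is the inequality `∫ f dμ ≤ b` of real numbers. -/
def IntegralLE {α : Type*} [MeasurableSpace α] (μ : Measure α) (f : α → ℝ) (b : ℝ) : Prop :=
  ∫⁻ a, ENNReal.ofReal (f a) ∂μ ≠ ⊤ ∧
    ((∫⁻ a, ENNReal.ofReal (f a) ∂μ : ℝ≥0∞) : EReal) -
      ((∫⁻ a, ENNReal.ofReal (-f a) ∂μ : ℝ≥0∞) : EReal) ≤ (b : EReal)

theorem integralLE_iff_of_integrable {α : Type*} [MeasurableSpace α] {μ : Measure α} {f : α → ℝ}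
    (hf : Integrable f μ) (b : ℝ) : IntegralLE μ f b ↔ ∫ a, f a ∂μ ≤ b := by
  have h1 : ∫⁻ a, ENNReal.ofReal (f a) ∂μ ≠ ⊤ := by
    have := hf.lintegral_lt_top
    exact this.ne
  have h2 : ∫⁻ a, ENNReal.ofReal (-f a) ∂μ ≠ ⊤ := by
    have := hf.neg.lintegral_lt_top
    exact this.ne
  rw [IntegralLE, and_iff_right h1, integral_eq_lintegral_pos_part_sub_lintegral_neg_part hf,
    ← EReal.coe_ennreal_toReal h1, ← EReal.coe_ennreal_toReal h2]
  exact_mod_cast Iff.rfl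

/-- A distortion weight function: nonnegative on `(0,1)`, square-integrable, of integral one. -/
structure IsDistortionWeight (γ : ℝ → ℝ) : Prop where
  nonneg : ∀ u ∈ Ioo (0 : ℝ) 1, 0 ≤ γ u
  memLp : MemLp γ 2 unif
  integral_eq_one : ∫ u, γ u ∂unif = 1

/-- The distortion risk measure evaluated on a quantile function. -/
def risk (γ g : ℝ → ℝ) : ℝ := -∫ u, g u * γ u ∂unif

/-- The square-integrable quantile functions: functions on `(0,1)` that are non-decreasing,
left-continuous and in `L²`. Values outside `(0,1)` are irrelevant. -/
def quantileFns : Set (ℝ → ℝ) :=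
  {g | MonotoneOn g (Ioo 0 1) ∧ (∀ u ∈ Ioo (0 : ℝ) 1, ContinuousWithinAt g (Iic u) u) ∧
    MemLp g 2 unif}

section Model

variable {Ω : Type*} (FT : MeasurableSpace Ω) [mΩ : MeasurableSpace Ω] (P : Measure Ω)

/-- The distortion risk measure of a random variable, through its quantile function. -/
def riskRV (γ : ℝ → ℝ) (X : Ω → ℝ) : ℝ := risk γ (quantile (P.map X))

/-- The cost `X₀ = E[ς B]` of the benchmark terminal wealth `B`, for the stochastic discount
factor `ς`. -/
def cost (ς B : Ω → ℝ) : ℝ := ∫ ω, ς ω * B ω ∂P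

/-- `U = F(B)`, the benchmark terminal wealth put through its own distribution function. -/
def rankRV (B : Ω → ℝ) (ω : Ω) : ℝ := cdf (P.map B) (B ω)

variable [IsFiniteMeasure P]

/-- The conditional law of the stochastic discount factor `ς` given `U = u`. -/
def condLawSDF (ς B : Ω → ℝ) (u : ℝ) : Measure ℝ := condDistrib ς (rankRV P B) P u

/-- `V = C⁻¹(1 - F_{ς|U}(ς | U) | U)`. -/
def coupledRV (C : Copula) (ς B : Ω → ℝ) (ω : Ω) : ℝ :=
  C.condInv (1 - cdf (condLawSDF P ς B (rankRV P B ω)) (ς ω)) (rankRV P B ω)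

/-- `ξ(u) = E[ς | V = u]`. -/
def condSDF (C : Copula) (ς B : Ω → ℝ) (u : ℝ) : ℝ :=
  ∫ z, z ∂(condDistrib ς (coupledRV P C ς B) P u)

/-- The random variables admissible for the problem over terminal wealths: square-integrable,
measurable at the horizon (up to null sets), having copula `C` with the benchmark `B`, within
Wasserstein distance `ε` of `B`, and not more expensive than `B`. -/
def feasibleRV (C : Copula) (ς B : Ω → ℝ) (ε : ℝ) : Set (Ω → ℝ) :=
  {X | MemLp X 2 P ∧ AEStronglyMeasurable[FT] X P ∧ HasCopula P X B C ∧
    wasserstein (P.map X) (P.map B) ≤ ENNReal.ofReal ε ∧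
    IntegralLE P (fun ω => ς ω * X ω) (cost P ς B)}

/-- The quantile functions admissible for the quantile problem: within `L²` distance `ε` of the
benchmark's quantile function and satisfying the budget constraint. -/
def feasibleQ (C : Copula) (ς B : Ω → ℝ) (ε : ℝ) : Set (ℝ → ℝ) :=
  {g | g ∈ quantileFns ∧ ∫ u, (g u - quantile (P.map B) u) ^ 2 ∂unif ≤ ε ^ 2 ∧
    IntegralLE unif (fun u => g u * condSDF P C ς B u) (cost P ς B)}

end Model

end Portfolio

end

/-! The maps `g ↦ g(V)` and `X ↦ F_X⁻¹` send the admissible set of each problem into that of the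
other and preserve the objective, so a minimiser of one problem yields a minimiser of the other.

Given `U = F(B)`, the residual `1 - F_{ς|U}(ς | U)` is uniform, hence independent of `U`; feeding it
to the conditional quantile of the copula gives `(V, U)` the law `C` (`map_coupledRV_rankRV`). So
`V` is uniform, `g(V)` has quantile function `g`, and its copula with `B` is `C`. The distance
constraints match because the comonotone coupling is optimal for the quadratic cost
(`lintegral_sq_quantile_sub_le`), and the budgets of `g(V)` and `g` agree by conditioning on `V`
(`lintegral_ofReal_mul_comp_eq`).

What remains is that `Y = F_X⁻¹(V)` costs no more than `X`. Given `U`, `V` decreases in `ς`, so the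
overlap of `{t < Y}` with `{s < ς}` attains the Fréchet lower bound, while `X` has the same
conditional tail probabilities given `U` (`measure_inter_le_of_countermonotone`). Integrating over
`s` compares the tails of `Y` and `X` under the measure `ς dP` (`withDensity_lt_le`), and
integrating over `t` compares the costs, positive and negative parts separately. -/

namespace Portfolio

/-! ### The uniform distribution and quantile functions -/

instance : IsProbabilityMeasure unif := ⟨by simp [unif]⟩

theorem ae_unif_mem_Ioo : ∀ᵐ u ∂unif, u ∈ Ioo (0 : ℝ) 1 :=
  ae_restrict_mem measurableSet_Ioo

theorem unif_Iic {a : ℝ} (h0 : 0 ≤ a) (h1 : a ≤ 1) : unif (Iic a) = ENNReal.ofReal a := by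
  rw [unif, Measure.restrict_apply measurableSet_Iic]
  rcases h1.lt_or_eq with h | rfl
  · have : Iic a ∩ Ioo 0 1 = Ioc 0 a := by
      ext x; simp only [mem_inter_iff, mem_Iic, mem_Ioo, mem_Ioc]
      constructor
      · rintro ⟨h1, h2, -⟩; exact ⟨h2, h1⟩
      · rintro ⟨h1, h2⟩; exact ⟨h2, h1, h2.trans_lt h⟩
    rw [this, Real.volume_Ioc, sub_zero]
  · have : Iic (1 : ℝ) ∩ Ioo 0 1 = Ioo 0 1 :=
      inter_eq_right.2 fun x hx => hx.2.le
    rw [this, Real.volume_Ioo, sub_zero]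

/-- Right-continuity of the distribution function makes the infimum attained. Levels in `(0,1)` keep
the set nonempty and bounded below, away from the default value of `sInf`. -/
theorem quantile_le_iff (μ : Measure ℝ) {u : ℝ} (hu : u ∈ Ioo (0 : ℝ) 1) (y : ℝ) :
    quantile μ u ≤ y ↔ u ≤ cdf μ y := by
  have hne : {y : ℝ | u ≤ cdf μ y}.Nonempty := by
    obtain ⟨y, hy⟩ := ((tendsto_cdf_atTop μ).eventually (lt_mem_nhds hu.2)).exists
    exact ⟨y, hy.le⟩
  have hbdd : BddBelow {y : ℝ | u ≤ cdf μ y} := by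
    obtain ⟨y, hy⟩ := ((tendsto_cdf_atBot μ).eventually (gt_mem_nhds hu.1)).exists
    refine ⟨y, fun z hz => ?_⟩
    by_contra! h
    exact absurd ((monotone_cdf μ) h.le) (not_le.2 (hy.trans_le hz))
  constructor
  · intro h
    have hr : ContinuousWithinAt (cdf μ) (Ioi y) y :=
      (cdf μ).right_continuous y |>.mono Ioi_subset_Ici_self
    refine ge_of_tendsto hr ?_
    filter_upwards [self_mem_nhdsWithin] with z hz
    obtain ⟨w, hw, hwz⟩ := (csInf_lt_iff hbdd hne).1 (lt_of_le_of_lt h hz)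
    exact le_trans hw (monotone_cdf μ hwz.le)
  · intro h
    exact csInf_le hbdd h

theorem lt_quantile_iff (μ : Measure ℝ) {u : ℝ} (hu : u ∈ Ioo (0 : ℝ) 1) (y : ℝ) :
    y < quantile μ u ↔ cdf μ y < u := by
  rw [← not_le, quantile_le_iff μ hu, not_le]

theorem monotoneOn_quantile (μ : Measure ℝ) : MonotoneOn (quantile μ) (Ioo 0 1) := by
  intro u hu v hv huv
  rw [quantile_le_iff μ hu]
  exact huv.trans ((quantile_le_iff μ hv _).1 le_rfl)

/-- Lower bounds persist nearby because `y < quantile μ u` is the open condition `cdf μ y < u` on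
`u`; upper bounds persist to the left by monotonicity. -/
theorem continuousWithinAt_quantile (μ : Measure ℝ) {u : ℝ} (hu : u ∈ Ioo (0 : ℝ) 1) :
    ContinuousWithinAt (quantile μ) (Iic u) u := by
  have hmem : ∀ᶠ v in nhdsWithin u (Iic u), v ∈ Ioo (0 : ℝ) 1 :=
    nhdsWithin_le_nhds (Ioo_mem_nhds hu.1 hu.2)
  refine tendsto_order.2 ⟨fun y hy => ?_, fun y hy => ?_⟩
  · have hy' := (lt_quantile_iff μ hu y).1 hy
    filter_upwards [hmem, nhdsWithin_le_nhds (lt_mem_nhds hy')] with v hv hyv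
    exact (lt_quantile_iff μ hv y).2 hyv
  · filter_upwards [hmem, self_mem_nhdsWithin] with v hv hvu
    exact (monotoneOn_quantile μ hv hu hvu).trans_lt hy

theorem aemeasurable_quantile (μ : Measure ℝ) : AEMeasurable (quantile μ) unif :=
  aemeasurable_restrict_of_monotoneOn measurableSet_Ioo (monotoneOn_quantile μ)

theorem map_quantile (μ : Measure ℝ) [IsProbabilityMeasure μ] : unif.map (quantile μ) = μ := by
  refine Measure.ext_of_Iic _ _ fun y => ?_
  rw [Measure.map_apply_of_aemeasurable (aemeasurable_quantile μ) measurableSet_Iic,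
    ← ofReal_cdf, ← unif_Iic (cdf_nonneg μ y) (cdf_le_one μ y)]
  refine measure_congr ?_
  filter_upwards [ae_unif_mem_Ioo] with u hu
  exact propext (quantile_le_iff μ hu y)

theorem cdf_quantile {μ : Measure ℝ} (hμ : Continuous (cdf μ)) {u : ℝ} (hu : u ∈ Ioo (0 : ℝ) 1) :
    cdf μ (quantile μ u) = u := by
  refine le_antisymm ?_ ((quantile_le_iff μ hu _).1 le_rfl)
  -- Below the quantile the distribution function stays under `u`; continuity from the left excludes
  -- a jump past `u`.
  have hr : ContinuousWithinAt (cdf μ) (Iio (quantile μ u)) (quantile μ u) :=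
    hμ.continuousWithinAt
  refine le_of_tendsto hr ?_
  filter_upwards [self_mem_nhdsWithin] with y hy
  exact ((lt_quantile_iff μ hu y).1 hy).le

theorem map_cdf {μ : Measure ℝ} [IsProbabilityMeasure μ] (hμ : Continuous (cdf μ)) :
    μ.map (cdf μ) = unif := by
  have : (cdf μ ∘ quantile μ) =ᵐ[unif] id := by
    filter_upwards [ae_unif_mem_Ioo] with u hu
    exact cdf_quantile hμ hu
  have h := AEMeasurable.map_map_of_aemeasurable (μ := unif) (g := cdf μ)
    hμ.measurable.aemeasurable (aemeasurable_quantile μ)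
  rwa [map_quantile, Measure.map_congr this, Measure.map_id] at h

theorem map_one_sub_unif : unif.map (fun u => 1 - u) = unif := by
  refine Measure.ext fun s hs => ?_
  have hm : Measurable fun u : ℝ => 1 - u := by fun_prop
  rw [Measure.map_apply hm hs, unif, Measure.restrict_apply (hm hs), Measure.restrict_apply hs,
    ← (Measure.measurePreserving_sub_left volume (1 : ℝ)).measure_preimage
      (hs.inter measurableSet_Ioo).nullMeasurableSet]
  congr 1
  ext x; simp [and_comm]

theorem map_one_sub_cdf {μ : Measure ℝ} [IsProbabilityMeasure μ] (hμ : Continuous (cdf μ)) :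
    μ.map (fun z => 1 - cdf μ z) = unif := by
  rw [← map_one_sub_unif, ← map_cdf hμ, Measure.map_map (by fun_prop) hμ.measurable]
  rfl

/-! ### Square-integrable quantile functions -/

/-- Up to null sets `{g ≤ x}` is an initial interval of `(0,1)`. If `g v > x`, left-continuity gives
`g > x` already from some point before `v`, so this interval has length less than `v`. -/
theorem le_cdf_map_iff {g : ℝ → ℝ} (hg : g ∈ quantileFns) {v : ℝ} (hv : v ∈ Ioo (0 : ℝ) 1)
    (x : ℝ) : v ≤ cdf (unif.map g) x ↔ g v ≤ x := by
  obtain ⟨hmono, hcont, hL2⟩ := hg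
  have hm : AEMeasurable g unif := hL2.1.aemeasurable
  have := Measure.isProbabilityMeasure_map hm
  have hcdf : ENNReal.ofReal (cdf (unif.map g) x) = unif {u | g u ≤ x} := by
    rw [ofReal_cdf, Measure.map_apply_of_aemeasurable hm measurableSet_Iic]; rfl
  constructor
  · intro h
    by_contra! hlt
    have hev := (hcont v hv).eventually (lt_mem_nhds hlt)
    obtain ⟨w, hwv, hw⟩ := (mem_nhdsLE_iff_exists_Ioc_subset' hv.1).1 hev
    -- The point `w` may be negative, whereas `unif_Iic` needs a level in `[0,1]`.
    have hw' : max w 0 ∈ Ico 0 v := ⟨le_max_right _ _, max_lt hwv hv.1⟩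
    have hsub : unif {u | g u ≤ x} ≤ unif (Iic (max w 0)) := by
      refine measure_mono_ae ?_
      filter_upwards [ae_unif_mem_Ioo] with u hu hgu
      by_contra! hu'
      have hu'' : max w 0 < u := not_le.1 hu'
      rcases le_or_gt u v with huv | huv
      · exact absurd (hw ⟨(le_max_left _ _).trans_lt hu'', huv⟩) (not_lt.2 hgu)
      · exact absurd ((hlt.trans_le (hmono hv hu huv.le))) (not_lt.2 hgu)
    rw [← hcdf, unif_Iic hw'.1 (hw'.2.le.trans hv.2.le),
      ENNReal.ofReal_le_ofReal_iff hw'.1] at hsub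
    exact absurd hw'.2 (not_lt.2 (h.trans hsub))
  · intro h
    have hsub : unif (Iic v) ≤ unif {u | g u ≤ x} := by
      refine measure_mono_ae ?_
      filter_upwards [ae_unif_mem_Ioo] with u hu huv
      exact (hmono hu hv huv).trans h
    rwa [← hcdf, unif_Iic hv.1.le hv.2.le, ENNReal.ofReal_le_ofReal_iff (cdf_nonneg _ _)] at hsub

theorem quantile_map_eq {g : ℝ → ℝ} (hg : g ∈ quantileFns) {v : ℝ} (hv : v ∈ Ioo (0 : ℝ) 1) :
    quantile (unif.map g) v = g v :=
  eq_of_forall_ge_iff fun x => by rw [quantile_le_iff _ hv, le_cdf_map_iff hg hv]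

theorem quantile_map_ae_eq {g : ℝ → ℝ} (hg : g ∈ quantileFns) :
    quantile (unif.map g) =ᵐ[unif] g := by
  filter_upwards [ae_unif_mem_Ioo] with v hv
  exact quantile_map_eq hg hv

theorem quantile_mem_quantileFns {μ : Measure ℝ} [IsProbabilityMeasure μ] (hμ : MemLp id 2 μ) :
    quantile μ ∈ quantileFns := by
  refine ⟨monotoneOn_quantile μ, fun u hu => continuousWithinAt_quantile μ hu, ?_⟩
  rw [← map_quantile μ] at hμ
  exact (memLp_map_measure_iff hμ.1 (aemeasurable_quantile μ)).1 hμ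

/-! ### Conditional distribution functions and the law of the coupled variable -/

theorem measurable_cdf_kernel (η : Kernel ℝ ℝ) [IsMarkovKernel η] :
    Measurable fun p : ℝ × ℝ => cdf (η p.1) p.2 := by
  have hs : MeasurableSet {q : (ℝ × ℝ) × ℝ | q.2 ≤ q.1.2} :=
    measurableSet_le measurable_snd (measurable_snd.comp measurable_fst)
  have h := Kernel.measurable_kernel_prodMk_left (κ := η.comap Prod.fst measurable_fst) hs
  have he : (fun p : ℝ × ℝ => cdf (η p.1) p.2) = fun p : ℝ × ℝ =>
      ((η.comap Prod.fst measurable_fst : Kernel (ℝ × ℝ) ℝ) p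
        (Prod.mk p ⁻¹' {q : (ℝ × ℝ) × ℝ | q.2 ≤ q.1.2})).toReal := by
    funext p
    rw [cdf_eq_real]
    rfl
  rw [he]
  exact h.ennreal_toReal

/-- On `(0,1)` sublevel sets of the quantile become conditions on the jointly measurable
distribution function. The indicator discards the meaningless values of `sInf` at other levels. -/
theorem measurable_indicator_quantile_kernel (κ : Kernel ℝ ℝ) [IsMarkovKernel κ] :
    Measurable fun p : ℝ × ℝ => (Ioo (0 : ℝ) 1).indicator (quantile (κ p.1)) p.2 := by
  refine measurable_of_Iic fun y => ?_
  have hF : Measurable fun p : ℝ × ℝ => cdf (κ p.1) y :=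
    (measurable_cdf_kernel κ).comp (measurable_fst.prodMk measurable_const)
  have hI : MeasurableSet {p : ℝ × ℝ | p.2 ∈ Ioo (0 : ℝ) 1} := measurable_snd measurableSet_Ioo
  have : (fun p : ℝ × ℝ => (Ioo (0 : ℝ) 1).indicator (quantile (κ p.1)) p.2) ⁻¹' Iic y =
      ({p | p.2 ∈ Ioo (0 : ℝ) 1} ∩ {p | p.2 ≤ cdf (κ p.1) y}) ∪
        ({p | p.2 ∈ Ioo (0 : ℝ) 1}ᶜ ∩ {_p | 0 ≤ y}) := by
    ext p
    by_cases hp : p.2 ∈ Ioo (0 : ℝ) 1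
    · simp only [mem_preimage, indicator_of_mem hp, mem_Iic, quantile_le_iff _ hp, mem_union,
        mem_inter_iff, mem_ofPred_eq, hp, mem_compl_iff, true_and, not_true_eq_false, false_and,
        or_false]
    · simp only [mem_preimage, indicator_of_notMem hp, mem_Iic, mem_union,
        mem_inter_iff, mem_ofPred_eq, hp, mem_compl_iff, true_and, not_false_eq_true, false_and,
        false_or]
  rw [this]
  exact (hI.inter (measurableSet_le measurable_snd hF)).union
    (hI.compl.inter (MeasurableSet.const _))

/-- Transforming the second coordinate of a disintegrated law fibrewise. -/
theorem map_compProd_eq {Ω : Type*} [MeasurableSpace Ω] {P : Measure Ω} [IsProbabilityMeasure P]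
    {U : Ω → ℝ} (hU : Measurable U) (η κ : Kernel ℝ ℝ) [IsMarkovKernel η] [IsMarkovKernel κ]
    {f : ℝ × ℝ → ℝ} (hf : Measurable f)
    (h : ∀ᵐ ω ∂P, (η (U ω)).map (fun z => f (U ω, z)) = κ (U ω)) :
    (P.map U ⊗ₘ η).map (fun p => (p.1, f p)) = P.map U ⊗ₘ κ := by
  have hf' : Measurable fun p : ℝ × ℝ => (p.1, f p) := measurable_fst.prodMk hf
  refine Measure.ext fun s hs => ?_
  rw [Measure.map_apply hf' hs, Measure.compProd_apply (hf' hs), Measure.compProd_apply hs,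
    lintegral_map (Kernel.measurable_kernel_prodMk_left (hf' hs)) hU,
    lintegral_map (Kernel.measurable_kernel_prodMk_left hs) hU]
  refine lintegral_congr_ae ?_
  filter_upwards [h] with ω hω
  have hfω : Measurable fun z => f (U ω, z) := hf.comp measurable_prodMk_left
  rw [← hω, Measure.map_apply hfω (measurable_prodMk_left hs)]
  rfl

theorem measurable_rankRV {Ω : Type*} [MeasurableSpace Ω] {P : Measure Ω} {B : Ω → ℝ}
    (hB : Measurable B) : Measurable (rankRV P B) :=
  (monotone_cdf _).measurable.comp hB

section

variable {Ω : Type*} [mΩ : MeasurableSpace Ω] {P : Measure Ω} [IsProbabilityMeasure P]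
  {ς B : Ω → ℝ}

theorem map_rankRV (hB : Measurable B) (hB_cont : Continuous (cdf (P.map B))) :
    P.map (rankRV P B) = unif := by
  have := Measure.isProbabilityMeasure_map (μ := P) hB.aemeasurable
  rw [← map_cdf hB_cont, Measure.map_map hB_cont.measurable hB]
  rfl

/-- The conditional distributional transform of the discount factor is uniform and independent of
the rank of the benchmark. -/
theorem map_rankRV_residual (hς : Measurable ς) (hB : Measurable B)
    (hB_cont : Continuous (cdf (P.map B)))
    (hς_cont : ∀ᵐ ω ∂P, Continuous (cdf (condLawSDF P ς B (rankRV P B ω)))) :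
    P.map (fun ω => (rankRV P B ω, 1 - cdf (condLawSDF P ς B (rankRV P B ω)) (ς ω))) =
      unif ⊗ₘ Kernel.const ℝ unif := by
  have hU := measurable_rankRV (P := P) hB
  have hF : Measurable fun p : ℝ × ℝ => 1 - cdf (condDistrib ς (rankRV P B) P p.1) p.2 :=
    measurable_const.sub (measurable_cdf_kernel _)
  have h := map_compProd_eq hU (condDistrib ς (rankRV P B) P) (Kernel.const ℝ unif) hF (by
    filter_upwards [hς_cont] with ω hω
    rw [Kernel.const_apply]
    exact map_one_sub_cdf hω)
  rw [compProd_map_condDistrib hς.aemeasurable, Measure.map_map (measurable_fst.prodMk hF)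
    (hU.prodMk hς), map_rankRV hB hB_cont] at h
  exact h

theorem ae_residual_mem_Ioo (hς : Measurable ς) (hB : Measurable B)
    (hB_cont : Continuous (cdf (P.map B)))
    (hς_cont : ∀ᵐ ω ∂P, Continuous (cdf (condLawSDF P ς B (rankRV P B ω)))) :
    ∀ᵐ ω ∂P, 1 - cdf (condLawSDF P ς B (rankRV P B ω)) (ς ω) ∈ Ioo (0 : ℝ) 1 := by
  have hU := measurable_rankRV (P := P) hB
  have h := map_rankRV_residual hς hB hB_cont hς_cont
  have hm : Measurable fun ω =>
      (rankRV P B ω, 1 - cdf (condLawSDF P ς B (rankRV P B ω)) (ς ω)) :=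
    hU.prodMk (measurable_const.sub
      ((measurable_cdf_kernel (condDistrib ς (rankRV P B) P)).comp (hU.prodMk hς)))
  have : ∀ᵐ p ∂(unif ⊗ₘ Kernel.const ℝ unif), p.2 ∈ Ioo (0 : ℝ) 1 := by
    refine (Measure.ae_compProd_iff (measurable_snd measurableSet_Ioo)).2 ?_
    exact ae_of_all _ fun u => by simpa using ae_unif_mem_Ioo
  rw [← h] at this
  exact ae_of_ae_map hm.aemeasurable this

/-- A version of the coupled variable that is a Borel function of `(ς, B)`. -/
theorem coupledRV_ae_eq (C : Copula) (hς : Measurable ς) (hB : Measurable B)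
    (hB_cont : Continuous (cdf (P.map B)))
    (hς_cont : ∀ᵐ ω ∂P, Continuous (cdf (condLawSDF P ς B (rankRV P B ω)))) :
    coupledRV P C ς B =ᵐ[P] fun ω => (Ioo (0 : ℝ) 1).indicator
      (quantile (condDistrib Prod.fst Prod.snd C.law (rankRV P B ω)))
      (1 - cdf (condLawSDF P ς B (rankRV P B ω)) (ς ω)) := by
  filter_upwards [ae_residual_mem_Ioo hς hB hB_cont hς_cont] with ω hω
  rw [indicator_of_mem hω]
  rfl

theorem exists_measurable_coupledRV_ae_eq (C : Copula) (hς : Measurable ς) (hB : Measurable B)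
    (hB_cont : Continuous (cdf (P.map B)))
    (hς_cont : ∀ᵐ ω ∂P, Continuous (cdf (condLawSDF P ς B (rankRV P B ω)))) :
    ∃ q : ℝ × ℝ → ℝ, Measurable q ∧ coupledRV P C ς B =ᵐ[P] fun ω => q (ς ω, B ω) := by
  have hU : Measurable fun p : ℝ × ℝ => cdf (P.map B) p.2 :=
    (monotone_cdf _).measurable.comp measurable_snd
  have hW : Measurable fun p : ℝ × ℝ =>
      1 - cdf (condDistrib ς (rankRV P B) P (cdf (P.map B) p.2)) p.1 :=
    measurable_const.sub
      ((measurable_cdf_kernel (condDistrib ς (rankRV P B) P)).comp (hU.prodMk measurable_fst))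
  exact ⟨_, (measurable_indicator_quantile_kernel (condDistrib Prod.fst Prod.snd C.law)).comp
    (hU.prodMk hW), coupledRV_ae_eq C hς hB hB_cont hς_cont⟩

theorem aemeasurable_coupledRV (C : Copula) (hς : Measurable ς) (hB : Measurable B)
    (hB_cont : Continuous (cdf (P.map B)))
    (hς_cont : ∀ᵐ ω ∂P, Continuous (cdf (condLawSDF P ς B (rankRV P B ω)))) :
    AEMeasurable (coupledRV P C ς B) P := by
  obtain ⟨q, hq, h⟩ := exists_measurable_coupledRV_ae_eq C hς hB hB_cont hς_cont
  exact ⟨_, hq.comp (hς.prodMk hB), h⟩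

/-- The coupled variable and the rank of the benchmark are distributed according to the copula. -/
theorem map_coupledRV_rankRV (C : Copula) (hς : Measurable ς) (hB : Measurable B)
    (hB_cont : Continuous (cdf (P.map B)))
    (hς_cont : ∀ᵐ ω ∂P, Continuous (cdf (condLawSDF P ς B (rankRV P B ω)))) :
    P.map (fun ω => (coupledRV P C ς B ω, rankRV P B ω)) = C.law := by
  have hU := measurable_rankRV (P := P) hB
  have hV := aemeasurable_coupledRV C hς hB hB_cont hς_cont
  set κ := condDistrib Prod.fst Prod.snd C.law
  have hq := measurable_indicator_quantile_kernel κ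
  have hm : Measurable fun ω =>
      (rankRV P B ω, 1 - cdf (condLawSDF P ς B (rankRV P B ω)) (ς ω)) :=
    hU.prodMk (measurable_const.sub
      ((measurable_cdf_kernel (condDistrib ς (rankRV P B) P)).comp (hU.prodMk hς)))
  -- Fibrewise quantile transform: the conditional quantile sends the uniform residual to the
  -- conditional law of the copula.
  have h := map_compProd_eq hU (Kernel.const ℝ unif) κ hq (ae_of_all P fun ω => by
    rw [Kernel.const_apply]
    conv_rhs => rw [← map_quantile (κ (rankRV P B ω))]
    refine Measure.map_congr ?_
    filter_upwards [ae_unif_mem_Ioo] with u hu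
    exact indicator_of_mem hu _)
  rw [map_rankRV hB hB_cont, ← map_rankRV_residual hς hB hB_cont hς_cont,
    Measure.map_map (measurable_fst.prodMk hq) hm, ← C.map_snd,
    compProd_map_condDistrib measurable_fst.aemeasurable] at h
  have h2 : P.map (fun ω => (rankRV P B ω, coupledRV P C ς B ω)) = C.law.map Prod.swap := by
    refine (Measure.map_congr ?_).trans h
    filter_upwards [coupledRV_ae_eq C hς hB hB_cont hς_cont] with ω hω
    simp only [hω, Function.comp]
    rfl
  have h3 := congrArg (Measure.map Prod.swap) h2
  rw [Measure.map_map measurable_swap measurable_swap, Prod.swap_swap_eq, Measure.map_id,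
    AEMeasurable.map_map_of_aemeasurable measurable_swap.aemeasurable
      (hU.aemeasurable.prodMk hV)] at h3
  exact h3

theorem map_coupledRV (C : Copula) (hς : Measurable ς) (hB : Measurable B)
    (hB_cont : Continuous (cdf (P.map B)))
    (hς_cont : ∀ᵐ ω ∂P, Continuous (cdf (condLawSDF P ς B (rankRV P B ω)))) :
    P.map (coupledRV P C ς B) = unif := by
  have hV := aemeasurable_coupledRV C hς hB hB_cont hς_cont
  rw [← C.map_fst, ← map_coupledRV_rankRV C hς hB hB_cont hς_cont,
    AEMeasurable.map_map_of_aemeasurable measurable_fst.aemeasurable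
      (hV.prodMk (measurable_rankRV hB).aemeasurable)]
  rfl

/-- For a benchmark with continuous distribution function, `B ≤ y` and `F(B) ≤ F(y)` agree up to
null sets. -/
theorem ae_le_iff_rankRV_le (hB : Measurable B) (hB_cont : Continuous (cdf (P.map B))) (y : ℝ) :
    ∀ᵐ ω ∂P, B ω ≤ y ↔ rankRV P B ω ≤ cdf (P.map B) y := by
  have := Measure.isProbabilityMeasure_map (μ := P) hB.aemeasurable
  have h : {ω | B ω ≤ y} =ᵐ[P] {ω | rankRV P B ω ≤ cdf (P.map B) y} := by
    -- Only one inclusion holds pointwise, since the distribution function may be flat; equality of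
    -- the two probabilities makes the difference null.
    refine ae_eq_of_subset_of_measure_ge (fun ω hω => monotone_cdf _ hω) ?_
      (hB measurableSet_Iic).nullMeasurableSet (measure_ne_top _ _)
    change P (rankRV P B ⁻¹' Iic _) ≤ P (B ⁻¹' Iic y)
    rw [← Measure.map_apply (measurable_rankRV hB) measurableSet_Iic, map_rankRV hB hB_cont,
      ← Measure.map_apply hB measurableSet_Iic, unif_Iic (cdf_nonneg _ _) (cdf_le_one _ _),
      ofReal_cdf]
  filter_upwards [h] with ω hω
  exact iff_of_eq hω

theorem hasCopula_comp_coupledRV (C : Copula) (hς : Measurable ς) (hB : Measurable B)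
    (hB_cont : Continuous (cdf (P.map B)))
    (hς_cont : ∀ᵐ ω ∂P, Continuous (cdf (condLawSDF P ς B (rankRV P B ω))))
    {g : ℝ → ℝ} (hg : g ∈ quantileFns) :
    HasCopula P (fun ω => g (coupledRV P C ς B ω)) B C := by
  intro x y
  have hU := measurable_rankRV (P := P) hB
  have hV := aemeasurable_coupledRV C hς hB hB_cont hς_cont
  have hVu := map_coupledRV C hς hB hB_cont hς_cont
  have hV01 : ∀ᵐ ω ∂P, coupledRV P C ς B ω ∈ Ioo (0 : ℝ) 1 :=
    ae_of_ae_map hV (by rw [hVu]; exact ae_unif_mem_Ioo)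
  have hlaw : P.map (fun ω => g (coupledRV P C ς B ω)) = unif.map g := by
    rw [← hVu, AEMeasurable.map_map_of_aemeasurable
      (by rw [hVu]; exact hg.2.2.1.aemeasurable) hV]
    rfl
  rw [hlaw, Copula.df, ← map_coupledRV_rankRV C hς hB hB_cont hς_cont, measureReal_def,
    measureReal_def, Measure.map_apply_of_aemeasurable (hV.prodMk hU.aemeasurable)
      (measurableSet_Iic.prod measurableSet_Iic)]
  congr 1
  refine measure_congr ?_
  filter_upwards [hV01, ae_le_iff_rankRV_le hB hB_cont y] with ω h1 h2
  refine propext ?_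
  change (g (coupledRV P C ς B ω) ≤ x ∧ B ω ≤ y) ↔ (coupledRV P C ς B ω ≤ _ ∧ rankRV P B ω ≤ _)
  rw [h2, le_cdf_map_iff hg h1]

end

/-! ### Optimality of the comonotone coupling for the quadratic cost -/

theorem lintegral_ofReal_eq_lintegral_meas_le {α : Type*} [MeasurableSpace α] {μ : Measure α}
    {f : α → ℝ} (hf : AEMeasurable f μ) :
    ∫⁻ a, ENNReal.ofReal (f a) ∂μ = ∫⁻ t in Ioi (0 : ℝ), μ {a | t ≤ f a} := by
  have h := lintegral_eq_lintegral_meas_le μ (f := fun a => max (f a) 0)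
    (ae_of_all _ fun _ => le_max_right _ _) (hf.max aemeasurable_const)
  simp only [ENNReal.ofReal_max, ENNReal.ofReal_zero, zero_le, sup_of_le_left] at h
  rw [h]
  refine setLIntegral_congr_fun measurableSet_Ioi fun t ht => ?_
  have ht' : ¬ t ≤ 0 := not_le.2 ht
  simp only [le_max_iff, ht', or_false]

theorem lintegral_ofReal_eq_lintegral_meas_lt {α : Type*} [MeasurableSpace α] {μ : Measure α}
    {f : α → ℝ} (hf : AEMeasurable f μ) :
    ∫⁻ a, ENNReal.ofReal (f a) ∂μ = ∫⁻ t in Ioi (0 : ℝ), μ {a | t < f a} := by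
  have h := lintegral_eq_lintegral_meas_lt μ (f := fun a => max (f a) 0)
    (ae_of_all _ fun _ => le_max_right _ _) (hf.max aemeasurable_const)
  simp only [ENNReal.ofReal_max, ENNReal.ofReal_zero, zero_le, sup_of_le_left] at h
  rw [h]
  refine setLIntegral_congr_fun measurableSet_Ioi fun t ht => ?_
  have ht' : ¬ t < 0 := not_lt.2 (le_of_lt ht)
  simp only [lt_max_iff, ht', or_false]

theorem lintegral_Iio_ofReal_sub (x y : ℝ) :
    ∫⁻ t in Iio y, ENNReal.ofReal (t - x) = ENNReal.ofReal ((max (y - x) 0) ^ 2 / 2) := by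
  rcases le_or_gt y x with h | h
  · rw [max_eq_right (by linarith), setLIntegral_congr_fun (g := fun _ => 0) measurableSet_Iio
      fun t ht => ENNReal.ofReal_eq_zero.2 (by have : t < y := ht; linarith)]
    simp
  · rw [max_eq_left (by linarith)]
    have hint : ∫ t in Ioo x y, (t - x) = (y - x) ^ 2 / 2 := by
      rw [← integral_Ioc_eq_integral_Ioo, ← intervalIntegral.integral_of_le h.le,
        intervalIntegral.integral_comp_sub_right (fun t => t) x, integral_id]
      ring
    rw [← hint, ofReal_integral_eq_lintegral_ofReal]
    · rw [← lintegral_indicator measurableSet_Iio, ← lintegral_indicator measurableSet_Ioo]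
      refine lintegral_congr fun t => ?_
      by_cases hx : x < t
      · by_cases hy : t < y <;> simp [indicator, hx, hy]
      · have : ENNReal.ofReal (t - x) = 0 := ENNReal.ofReal_eq_zero.2 (by linarith)
        simp [indicator, this]
    · have hc : Continuous fun t : ℝ => t - x := by fun_prop
      exact hc.integrableOn_Icc.mono_set Ioo_subset_Icc_self
    · filter_upwards [ae_restrict_mem measurableSet_Ioo] with t ht
      exact sub_nonneg.2 ht.1.le

/-- The one-sided quadratic cost is a superposition of indicators of quadrants `(-∞, t - r] × (t,
∞)`, so couplings can be compared on quadrants alone. -/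
theorem lintegral_sq_max_sub_eq (χ : Measure (ℝ × ℝ)) [IsFiniteMeasure χ] :
    ∫⁻ p, ENNReal.ofReal ((max (p.2 - p.1) 0) ^ 2 / 2) ∂χ =
      ∫⁻ t, ∫⁻ r in Ioi (0 : ℝ), χ {p | p.1 ≤ t - r ∧ t < p.2} := by
  simp_rw [← lintegral_Iio_ofReal_sub, ← lintegral_indicator measurableSet_Iio]
  rw [lintegral_lintegral_swap]
  · refine lintegral_congr fun t => ?_
    have hs : MeasurableSet {p : ℝ × ℝ | t < p.2} := measurableSet_lt measurable_const measurable_snd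
    have : ∀ p : ℝ × ℝ, (Iio p.2).indicator (fun t => ENNReal.ofReal (t - p.1)) t =
        {p : ℝ × ℝ | t < p.2}.indicator (fun p => ENNReal.ofReal (t - p.1)) p := fun p => rfl
    simp_rw [this]
    rw [lintegral_indicator hs, lintegral_ofReal_eq_lintegral_meas_le (by fun_prop)]
    refine lintegral_congr fun r => ?_
    rw [Measure.restrict_apply' hs]
    congr 1
    ext p
    simp only [mem_inter_iff, mem_ofPred_eq]
    rw [le_sub_comm]
  · have hs : MeasurableSet {q : (ℝ × ℝ) × ℝ | q.2 < q.1.2} :=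
      measurableSet_lt measurable_snd (by fun_prop)
    have : Measurable fun q : (ℝ × ℝ) × ℝ => {q : (ℝ × ℝ) × ℝ | q.2 < q.1.2}.indicator
        (fun q => ENNReal.ofReal (q.2 - q.1.1)) q := Measurable.indicator (by fun_prop) hs
    exact this.aemeasurable

/-- The quantile coupling gives each quadrant at most the positive part of `F_μ(t - r) - F_ν(t)`, a
lower bound for its mass under every coupling. -/
theorem lintegral_sq_max_sub_quantile_le {μ ν : Measure ℝ} [IsProbabilityMeasure μ]
    [IsProbabilityMeasure ν] {χ : Measure (ℝ × ℝ)} (hfst : χ.map Prod.fst = μ)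
    (hsnd : χ.map Prod.snd = ν) :
    ∫⁻ u, ENNReal.ofReal ((max (quantile ν u - quantile μ u) 0) ^ 2 / 2) ∂unif ≤
      ∫⁻ p, ENNReal.ofReal ((max (p.2 - p.1) 0) ^ 2 / 2) ∂χ := by
  have hχ : IsProbabilityMeasure χ := by
    have : IsProbabilityMeasure (χ.map Prod.fst) := by rw [hfst]; infer_instance
    exact Measure.isProbabilityMeasure_of_map Prod.fst
  have hq : AEMeasurable (fun u => (quantile μ u, quantile ν u)) unif :=
    (aemeasurable_quantile μ).prodMk (aemeasurable_quantile ν)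
  have := Measure.isProbabilityMeasure_map hq
  have h := lintegral_map' (μ := unif) (g := fun u => (quantile μ u, quantile ν u))
    (f := fun p : ℝ × ℝ => ENNReal.ofReal ((max (p.2 - p.1) 0) ^ 2 / 2)) (by fun_prop) hq
  rw [← h, lintegral_sq_max_sub_eq, lintegral_sq_max_sub_eq]
  refine lintegral_mono fun t => lintegral_mono fun r => ?_
  have hs : MeasurableSet {p : ℝ × ℝ | p.1 ≤ t - r ∧ t < p.2} :=
    (measurableSet_le measurable_fst measurable_const).inter
      (measurableSet_lt measurable_const measurable_snd)
  change Measure.map _ unif {p : ℝ × ℝ | p.1 ≤ t - r ∧ t < p.2} ≤ _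
  rw [Measure.map_apply_of_aemeasurable hq hs]
  calc unif ((fun u => (quantile μ u, quantile ν u)) ⁻¹' {p : ℝ × ℝ | p.1 ≤ t - r ∧ t < p.2})
      ≤ unif (Ioc (cdf ν t) (cdf μ (t - r))) := by
        refine measure_mono_ae ?_
        filter_upwards [ae_unif_mem_Ioo] with u hu h
        exact ⟨(lt_quantile_iff ν hu t).1 h.2, (quantile_le_iff μ hu _).1 h.1⟩
    _ ≤ ENNReal.ofReal (cdf μ (t - r) - cdf ν t) :=
        (Measure.restrict_apply_le _ _).trans_eq Real.volume_Ioc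
    _ = μ (Iic (t - r)) - ν (Iic t) := by
        rw [ENNReal.ofReal_sub _ (cdf_nonneg _ _), ofReal_cdf, ofReal_cdf]
    _ ≤ χ {p | p.1 ≤ t - r ∧ t < p.2} := by
        rw [tsub_le_iff_right, ← hfst, ← hsnd, Measure.map_apply measurable_fst measurableSet_Iic,
          Measure.map_apply measurable_snd measurableSet_Iic]
        refine (measure_mono fun p hp => ?_).trans (measure_union_le _ _)
        rcases lt_or_ge t p.2 with h | h
        · exact Or.inl ⟨hp, h⟩
        · exact Or.inr h

theorem lintegral_sq_quantile_sub_le {μ ν : Measure ℝ} [IsProbabilityMeasure μ]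
    [IsProbabilityMeasure ν] {χ : Measure (ℝ × ℝ)} (hfst : χ.map Prod.fst = μ)
    (hsnd : χ.map Prod.snd = ν) :
    ∫⁻ u, ENNReal.ofReal (|quantile μ u - quantile ν u| ^ 2) ∂unif ≤
      ∫⁻ p, ENNReal.ofReal (|p.1 - p.2| ^ 2) ∂χ := by
  have h1 := lintegral_sq_max_sub_quantile_le hfst hsnd
  have h2 := lintegral_sq_max_sub_quantile_le (χ := χ.map Prod.swap) (μ := ν) (ν := μ)
    (by rw [Measure.map_map measurable_fst measurable_swap]; exact hsnd)
    (by rw [Measure.map_map measurable_snd measurable_swap]; exact hfst)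
  rw [lintegral_map (by fun_prop) measurable_swap] at h2
  -- The square splits into two one-sided squares; the second is covered by the previous lemma
  -- applied to the swapped coupling.
  have key : ∀ x y : ℝ, ENNReal.ofReal (|x - y| ^ 2) =
      2 * (ENNReal.ofReal ((max (y - x) 0) ^ 2 / 2) + ENNReal.ofReal ((max (x - y) 0) ^ 2 / 2)) := by
    intro x y
    rw [← ENNReal.ofReal_add (by positivity) (by positivity), ← ENNReal.ofReal_ofNat,
      ← ENNReal.ofReal_mul (by norm_num), sq_abs]
    congr 1
    rcases le_total x y with h | h
    · rw [max_eq_left (by linarith), max_eq_right (by linarith)]; ring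
    · rw [max_eq_right (by linarith), max_eq_left (by linarith)]; ring
  have hμ := aemeasurable_quantile μ
  have hν := aemeasurable_quantile ν
  simp_rw [key]
  rw [lintegral_const_mul' _ _ (by simp), lintegral_const_mul' _ _ (by simp),
    lintegral_add_left' (by fun_prop), lintegral_add_left (by fun_prop)]
  gcongr
  exact h2

theorem lintegral_sq_sub_rpow_le_iff {g h : ℝ → ℝ} (hg : MemLp g 2 unif) (hh : MemLp h 2 unif)
    {ε : ℝ} (hε : 0 ≤ ε) :
    (∫⁻ u, ENNReal.ofReal (|g u - h u| ^ 2) ∂unif) ^ (1 / 2 : ℝ) ≤ ENNReal.ofReal ε ↔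
      ∫ u, (g u - h u) ^ 2 ∂unif ≤ ε ^ 2 := by
  have hint : Integrable (fun u => (g u - h u) ^ 2) unif := (hg.sub hh).integrable_sq
  simp_rw [sq_abs]
  rw [← ofReal_integral_eq_lintegral_ofReal hint
    (ae_of_all _ fun u => sq_nonneg _), one_div, ENNReal.rpow_inv_le_iff (by norm_num),
    ENNReal.rpow_two, ← ENNReal.ofReal_pow hε, ENNReal.ofReal_le_ofReal_iff (by positivity)]

theorem integral_sq_quantile_sub_le_of_wasserstein_le {μ ν : Measure ℝ} [IsProbabilityMeasure μ]
    [IsProbabilityMeasure ν] (hμ : MemLp (quantile μ) 2 unif) (hν : MemLp (quantile ν) 2 unif)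
    {ε : ℝ} (hε : 0 ≤ ε) (h : wasserstein μ ν ≤ ENNReal.ofReal ε) :
    ∫ u, (quantile μ u - quantile ν u) ^ 2 ∂unif ≤ ε ^ 2 := by
  rw [← lintegral_sq_sub_rpow_le_iff hμ hν hε]
  refine le_trans (le_iInf₂ fun χ hχ => ?_) h
  gcongr
  exact lintegral_sq_quantile_sub_le hχ.1 hχ.2

theorem wasserstein_le_of_integral_sq_sub_le {g h : ℝ → ℝ} (hg : MemLp g 2 unif)
    (hh : MemLp h 2 unif) {ε : ℝ} (hε : 0 ≤ ε) (hgh : ∫ u, (g u - h u) ^ 2 ∂unif ≤ ε ^ 2) :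
    wasserstein (unif.map g) (unif.map h) ≤ ENNReal.ofReal ε := by
  have hm : AEMeasurable (fun u => (g u, h u)) unif := hg.1.aemeasurable.prodMk hh.1.aemeasurable
  refine (iInf₂_le (unif.map fun u => (g u, h u)) ⟨?fst, ?snd⟩).trans ?_
  case fst => rw [AEMeasurable.map_map_of_aemeasurable measurable_fst.aemeasurable hm]; rfl
  case snd => rw [AEMeasurable.map_map_of_aemeasurable measurable_snd.aemeasurable hm]; rfl
  · rw [lintegral_map' (by fun_prop) hm]
    exact (lintegral_sq_sub_rpow_le_iff hg hh hε).2 hgh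

/-! ### The budget constraint -/

/-- As `ς ≥ 0`, the positive part of `ς h(V)` factors, and disintegration over `V` leaves the
conditional mean of `ς`. Taking `h = g` and `h = -g` gives both parts of the budget without
integrability of the product. -/
theorem lintegral_ofReal_mul_comp_eq {Ω : Type*} [MeasurableSpace Ω] {P : Measure Ω}
    [IsProbabilityMeasure P] {ς V : Ω → ℝ} (hς : Measurable ς) (hς_nonneg : 0 ≤ᵐ[P] ς)
    (hς_int : Integrable ς P) (hV : AEMeasurable V P) {h : ℝ → ℝ}
    (hh : AEMeasurable h (P.map V)) :
    ∫⁻ ω, ENNReal.ofReal (ς ω * h (V ω)) ∂P =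
      ∫⁻ v, ENNReal.ofReal (h v * ∫ z, z ∂(condDistrib ς V P v)) ∂(P.map V) := by
  have hpair : AEMeasurable (fun ω => (V ω, ς ω)) P := hV.prodMk hς.aemeasurable
  have hlaw : P.map V ⊗ₘ condDistrib ς V P = P.map fun ω => (V ω, ς ω) :=
    compProd_map_condDistrib hς.aemeasurable
  have := Measure.isProbabilityMeasure_map hV
  have hnn : ∀ᵐ v ∂(P.map V), ∀ᵐ z ∂(condDistrib ς V P v), 0 ≤ z := by
    have hset : MeasurableSet {p : ℝ × ℝ | 0 ≤ p.2} := measurableSet_le measurable_const measurable_snd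
    refine Measure.ae_ae_of_ae_compProd (p := fun p : ℝ × ℝ => 0 ≤ p.2) ?_
    rw [hlaw, ae_map_iff hpair hset]
    exact hς_nonneg
  have hint : ∀ᵐ v ∂(P.map V), Integrable (fun z => z) (condDistrib ς V P v) := by
    have h2 : Integrable (fun p : ℝ × ℝ => p.2) (P.map V ⊗ₘ condDistrib ς V P) := by
      rw [hlaw, integrable_map_measure (by fun_prop) hpair]
      exact hς_int
    exact ((Measure.integrable_compProd_iff (by fun_prop)).1 h2).1
  have hVmk : ∀ᵐ ω ∂P, h (V ω) = hh.mk h (V ω) := ae_of_ae_map hV hh.ae_eq_mk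
  have hmk := hh.measurable_mk
  calc ∫⁻ ω, ENNReal.ofReal (ς ω * h (V ω)) ∂P
      = ∫⁻ ω, ENNReal.ofReal (ς ω) * ENNReal.ofReal (hh.mk h (V ω)) ∂P := by
        refine lintegral_congr_ae ?_
        filter_upwards [hVmk, hς_nonneg] with ω h1 h2
        rw [h1, ENNReal.ofReal_mul h2]
    _ = ∫⁻ p, ENNReal.ofReal p.2 * ENNReal.ofReal (hh.mk h p.1) ∂(P.map V ⊗ₘ condDistrib ς V P) := by
        rw [hlaw, lintegral_map' (by fun_prop) hpair]
    _ = ∫⁻ v, (∫⁻ z, ENNReal.ofReal z ∂(condDistrib ς V P v)) * ENNReal.ofReal (hh.mk h v)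
          ∂(P.map V) := by
        rw [Measure.lintegral_compProd (by fun_prop)]
        refine lintegral_congr fun v => ?_
        exact lintegral_mul_const (μ := condDistrib ς V P v) (ENNReal.ofReal (hh.mk h v))
          ENNReal.measurable_ofReal
    _ = _ := by
        refine lintegral_congr_ae ?_
        filter_upwards [hnn, hint, hh.ae_eq_mk] with v h1 h2 h3
        rw [← ofReal_integral_eq_lintegral_ofReal h2 h1,
          ← ENNReal.ofReal_mul (integral_nonneg_of_ae h1), h3, mul_comm]

/-- If `D` is a sublevel set of `R` and `A` a superlevel set of `R` on each level set of `U`, then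
`D` minimises the mass of the overlap with `A` among the sets with the same conditional
probabilities given `U`. -/
theorem measure_inter_le_of_countermonotone {Ω : Type*} [MeasurableSpace Ω] {P : Measure Ω}
    [IsFiniteMeasure P] {U R : Ω → ℝ} {a b : ℝ → ℝ} (ha : Measurable a)
    (hb : Measurable b) {A D D' : Set Ω} (hA : MeasurableSet A) (hA_le : ∀ ω ∈ A, b (U ω) ≤ R ω)
    (hA_compl : ∀ ω ∉ A, R ω ≤ b (U ω)) (hD : D =ᵐ[P] {ω | R ω < a (U ω)})
    (h : ∀ E, MeasurableSet E → P (D ∩ U ⁻¹' E) ≤ P (D' ∩ U ⁻¹' E)) :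
    P (D ∩ A) ≤ P (D' ∩ A) := by
  set E := {u | b u < a u}
  have hE : MeasurableSet E := measurableSet_lt hb ha
  have hD' : ∀ᵐ ω ∂P, ω ∈ D ↔ R ω < a (U ω) := by
    filter_upwards [hD] with ω hω
    exact iff_of_eq hω
  -- Where `a ≤ b`, the sets `D` and `A` are disjoint up to a null set.
  have h1 : P (D ∩ A) ≤ P (D ∩ U ⁻¹' E ∩ A) := by
    refine measure_mono_ae ?_
    filter_upwards [hD'] with ω hω h
    exact ⟨⟨h.1, (hA_le ω h.2).trans_lt (hω.1 h.1)⟩, h.2⟩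
  -- Where `b < a`, the complement of `A` lies in `D`, so the overlap is as small as the mass of `D`
  -- permits.
  have h2 : P (U ⁻¹' E \ A) ≤ P ((D ∩ U ⁻¹' E) \ A) := by
    refine measure_mono_ae ?_
    filter_upwards [hD'] with ω hω h
    exact ⟨⟨hω.2 ((hA_compl ω h.2).trans_lt h.1), h.1⟩, h.2⟩
  have h3 : P (D ∩ U ⁻¹' E ∩ A) + P (U ⁻¹' E \ A) ≤ P (D' ∩ A) + P (U ⁻¹' E \ A) :=
    calc P (D ∩ U ⁻¹' E ∩ A) + P (U ⁻¹' E \ A)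
        ≤ P (D ∩ U ⁻¹' E ∩ A) + P ((D ∩ U ⁻¹' E) \ A) := by gcongr
      _ = P (D ∩ U ⁻¹' E) := measure_inter_add_sdiff _ hA
      _ ≤ P (D' ∩ U ⁻¹' E) := h E hE
      _ = P (D' ∩ U ⁻¹' E ∩ A) + P ((D' ∩ U ⁻¹' E) \ A) := (measure_inter_add_sdiff _ hA).symm
      _ ≤ P (D' ∩ A) + P (U ⁻¹' E \ A) := by
        gcongr
        · exact inter_subset_left
        · exact inter_subset_right
  exact h1.trans (ENNReal.le_of_add_le_add_right (measure_ne_top _ _) h3)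

section

variable {Ω : Type*} [mΩ : MeasurableSpace Ω] {P : Measure Ω} [IsProbabilityMeasure P]
  {ς B X Y : Ω → ℝ} {C : Copula}

/-- Equal marginals and a common copula give equal joint distribution functions; half-lines in the
second coordinate then determine all Borel sets. -/
theorem measure_le_inter_eq_of_hasCopula (hB : Measurable B)
    (hXY : P.map X = P.map Y) (hXC : HasCopula P X B C)
    (hYC : HasCopula P Y B C) (t : ℝ) {E : Set ℝ} (hE : MeasurableSet E) :
    P ({ω | X ω ≤ t} ∩ B ⁻¹' E) = P ({ω | Y ω ≤ t} ∩ B ⁻¹' E) := by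
  have h : (P.restrict {ω | X ω ≤ t}).map B = (P.restrict {ω | Y ω ≤ t}).map B := by
    refine Measure.ext_of_Iic _ _ fun y => ?_
    have h1 := hXC t y
    rw [hXY, ← hYC t y, measureReal_eq_measureReal_iff] at h1
    rw [Measure.map_apply hB measurableSet_Iic, Measure.map_apply hB measurableSet_Iic,
      Measure.restrict_apply (hB measurableSet_Iic), Measure.restrict_apply (hB measurableSet_Iic),
      inter_comm, inter_comm _ {ω | Y ω ≤ t}]
    exact h1
  have h2 := congrArg (fun μ => μ E) h
  simp only [Measure.map_apply hB hE, Measure.restrict_apply (hB hE)] at h2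
  rw [inter_comm, h2, inter_comm]

theorem measure_lt_inter_eq_of_hasCopula (hB : Measurable B) (hX : AEMeasurable X P)
    (hY : AEMeasurable Y P) (hXY : P.map X = P.map Y) (hXC : HasCopula P X B C)
    (hYC : HasCopula P Y B C) (t : ℝ) {E : Set ℝ} (hE : MeasurableSet E) :
    P ({ω | t < X ω} ∩ B ⁻¹' E) = P ({ω | t < Y ω} ∩ B ⁻¹' E) := by
  have key : ∀ {Z : Ω → ℝ}, AEMeasurable Z P →
      P ({ω | t < Z ω} ∩ B ⁻¹' E) = P (B ⁻¹' E) - P ({ω | Z ω ≤ t} ∩ B ⁻¹' E) := by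
    intro Z hZ
    have hs : NullMeasurableSet {ω | Z ω ≤ t} P := hZ.nullMeasurableSet_preimage measurableSet_Iic
    rw [← measure_inter_add_sdiff₀ (B ⁻¹' E) hs, inter_comm {ω | Z ω ≤ t},
      ENNReal.add_sub_cancel_left (measure_ne_top _ _)]
    congr 1
    ext ω
    simp [and_comm]
  rw [key hX, key hY, measure_le_inter_eq_of_hasCopula hB hXY hXC hYC t hE]

/-- Among the payoffs with a given law and copula with the benchmark, the one driven by the coupled
variable has the smallest upper tails under the pricing measure. -/
theorem withDensity_lt_le (hς : Measurable ς) (hB : Measurable B)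
    (hB_cont : Continuous (cdf (P.map B)))
    (hς_cont : ∀ᵐ ω ∂P, Continuous (cdf (condLawSDF P ς B (rankRV P B ω))))
    (hX : MemLp X 2 P) (hXC : HasCopula P X B C) (t : ℝ) :
    P.withDensity (fun ω => ENNReal.ofReal (ς ω))
        {ω | t < quantile (P.map X) (coupledRV P C ς B ω)} ≤
      P.withDensity (fun ω => ENNReal.ofReal (ς ω)) {ω | t < X ω} := by
  have hXm := hX.1.aemeasurable
  have := Measure.isProbabilityMeasure_map hXm
  have hU := measurable_rankRV (P := P) hB
  have hV := aemeasurable_coupledRV C hς hB hB_cont hς_cont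
  have hVu := map_coupledRV C hς hB hB_cont hς_cont
  have hV01 : ∀ᵐ ω ∂P, coupledRV P C ς B ω ∈ Ioo (0 : ℝ) 1 :=
    ae_of_ae_map hV (by rw [hVu]; exact ae_unif_mem_Ioo)
  have hq : quantile (P.map X) ∈ quantileFns := quantile_mem_quantileFns
    ((memLp_map_measure_iff (by fun_prop) hXm).2 hX)
  have hqm : AEMeasurable (quantile (P.map X)) (P.map (coupledRV P C ς B)) := by
    rw [hVu]; exact aemeasurable_quantile _
  have hY := hqm.comp_aemeasurable hV
  have hlaw : P.map (fun ω => quantile (P.map X) (coupledRV P C ς B ω)) = P.map X := by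
    conv_rhs => rw [← map_quantile (P.map X), ← hVu]
    rw [AEMeasurable.map_map_of_aemeasurable hqm hV]
    rfl
  -- Layer-cake formula in `ς`: it suffices to compare the overlaps with `{s < ς}` for each `s`.
  rw [withDensity_apply', withDensity_apply',
    lintegral_ofReal_eq_lintegral_meas_lt hς.aemeasurable,
    lintegral_ofReal_eq_lintegral_meas_lt hς.aemeasurable]
  refine lintegral_mono fun s => ?_
  have hA : MeasurableSet {ω | s < ς ω} := hς measurableSet_Ioi
  change P.restrict _ {ω | s < ς ω} ≤ P.restrict _ {ω | s < ς ω}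
  rw [Measure.restrict_apply hA, Measure.restrict_apply hA, inter_comm, inter_comm {ω | s < ς ω}]
  -- With `R = F_{ς|U}(ς | U)`, the event `t < F_X⁻¹(V)` means `F_X(t) < V`, that is `C(F_X(t) | U)
  -- < 1 - R`, whence the threshold `a`.
  refine measure_inter_le_of_countermonotone (U := rankRV P B)
    (R := fun ω => cdf (condLawSDF P ς B (rankRV P B ω)) (ς ω))
    (a := fun u => 1 - cdf (condDistrib Prod.fst Prod.snd C.law u) (cdf (P.map X) t))
    (b := fun u => cdf (condDistrib ς (rankRV P B) P u) s)
    (measurable_const.sub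
      ((measurable_cdf_kernel _).comp (measurable_id.prodMk measurable_const)))
    ((measurable_cdf_kernel _).comp (measurable_id.prodMk measurable_const)) hA
    (fun ω hω => monotone_cdf _ (le_of_lt hω)) (fun ω hω => monotone_cdf _ (not_lt.1 hω)) ?_ ?_
  · filter_upwards [hV01, ae_residual_mem_Ioo hς hB hB_cont hς_cont] with ω h1 h2
    refine propext ?_
    change t < quantile (P.map X) (coupledRV P C ς B ω) ↔ _ < (1 : ℝ) - _
    rw [lt_quantile_iff _ h1]
    change _ < quantile (condDistrib Prod.fst Prod.snd C.law (rankRV P B ω)) _ ↔ _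
    rw [lt_quantile_iff _ h2, lt_sub_comm]
  · intro E hE
    exact (measure_lt_inter_eq_of_hasCopula hB hY hXm hlaw
      (hasCopula_comp_coupledRV C hς hB hB_cont hς_cont hq) hXC t
      ((monotone_cdf (P.map B)).measurable hE)).le

end

theorem lintegral_ofReal_neg_eq_lintegral_meas_le {α : Type*} [MeasurableSpace α] {μ : Measure α}
    {f : α → ℝ} (hf : AEMeasurable f μ) :
    ∫⁻ a, ENNReal.ofReal (-f a) ∂μ = ∫⁻ t in Ioi (0 : ℝ), μ {a | f a ≤ -t} := by
  have h := lintegral_ofReal_eq_lintegral_meas_le (f := fun a => -f a) hf.neg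
  rw [h]
  simp only [le_neg]

/-- Costs are expectations under `Q = ς dP`. Smaller upper tails shrink the positive part; since `Q`
has finite mass, complements give larger lower tails, which enlarge the negative part. -/
theorem integralLE_mul_of_withDensity_lt_le {Ω : Type*} [MeasurableSpace Ω] {P : Measure Ω}
    {ς X Y : Ω → ℝ} (hς : Measurable ς) (hς_nonneg : 0 ≤ᵐ[P] ς)
    (hς_int : Integrable ς P) (hX : AEMeasurable X P) (hY : AEMeasurable Y P)
    (h : ∀ t : ℝ, P.withDensity (fun ω => ENNReal.ofReal (ς ω)) {ω | t < Y ω} ≤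
      P.withDensity (fun ω => ENNReal.ofReal (ς ω)) {ω | t < X ω})
    {b : ℝ} (hb : IntegralLE P (fun ω => ς ω * X ω) b) :
    IntegralLE P (fun ω => ς ω * Y ω) b := by
  set Q := P.withDensity (fun ω => ENNReal.ofReal (ς ω)) with hQ
  have hQP : Q ≪ P := withDensity_absolutelyContinuous _ _
  have hQf : IsFiniteMeasure Q := isFiniteMeasure_withDensity_ofReal hς_int.2
  have key : ∀ Z : Ω → ℝ, AEMeasurable Z P →
      ∫⁻ ω, ENNReal.ofReal (ς ω * Z ω) ∂P = ∫⁻ ω, ENNReal.ofReal (Z ω) ∂Q := by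
    intro Z hZ
    rw [hQ, lintegral_withDensity_eq_lintegral_mul₀ (by fun_prop) (by fun_prop)]
    refine lintegral_congr_ae ?_
    filter_upwards [hς_nonneg] with ω hω
    rw [ENNReal.ofReal_mul hω]
    rfl
  have hpos : ∫⁻ ω, ENNReal.ofReal (ς ω * Y ω) ∂P ≤ ∫⁻ ω, ENNReal.ofReal (ς ω * X ω) ∂P := by
    rw [key X hX, key Y hY, lintegral_ofReal_eq_lintegral_meas_lt (hX.mono_ac hQP),
      lintegral_ofReal_eq_lintegral_meas_lt (hY.mono_ac hQP)]
    exact lintegral_mono fun t => h t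
  have hneg : ∫⁻ ω, ENNReal.ofReal (-(ς ω * X ω)) ∂P ≤
      ∫⁻ ω, ENNReal.ofReal (-(ς ω * Y ω)) ∂P := by
    simp_rw [← mul_neg]
    have kX := key (fun ω => -X ω) hX.neg
    have kY := key (fun ω => -Y ω) hY.neg
    rw [kX, kY, lintegral_ofReal_neg_eq_lintegral_meas_le (hX.mono_ac hQP),
      lintegral_ofReal_neg_eq_lintegral_meas_le (hY.mono_ac hQP)]
    refine lintegral_mono fun t => ?_
    have hc : ∀ Z : Ω → ℝ, AEMeasurable Z P → Q {ω | Z ω ≤ -t} = Q univ - Q {ω | -t < Z ω} := by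
      intro Z hZ
      have hs : NullMeasurableSet {ω | -t < Z ω} Q :=
        (hZ.mono_ac hQP).nullMeasurableSet_preimage measurableSet_Ioi
      rw [← measure_compl₀ hs (measure_ne_top _ _)]
      congr 1
      ext ω
      simp
    change Q {ω | X ω ≤ -t} ≤ Q {ω | Y ω ≤ -t}
    rw [hc X hX, hc Y hY]
    exact tsub_le_tsub_left (h _) _
  refine ⟨ne_top_of_le_ne_top hb.1 hpos, (EReal.sub_le_sub ?_ ?_).trans hb.2⟩
  · exact_mod_cast hpos
  · exact_mod_cast hneg

/-! ### Equivalence of the two problems -/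

theorem risk_congr {γ g h : ℝ → ℝ} (hgh : g =ᵐ[unif] h) : risk γ g = risk γ h := by
  refine congrArg Neg.neg (integral_congr_ae ?_)
  filter_upwards [hgh] with u hu
  rw [hu]

section

variable {Ω : Type*} {FT : MeasurableSpace Ω} [mΩ : MeasurableSpace Ω] {P : Measure Ω}
  [IsProbabilityMeasure P] {ς B : Ω → ℝ} {C : Copula}

theorem map_comp_coupledRV (hς : Measurable ς) (hB : Measurable B)
    (hB_cont : Continuous (cdf (P.map B)))
    (hς_cont : ∀ᵐ ω ∂P, Continuous (cdf (condLawSDF P ς B (rankRV P B ω))))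
    {g : ℝ → ℝ} (hg : AEMeasurable g unif) :
    P.map (fun ω => g (coupledRV P C ς B ω)) = unif.map g := by
  have hVu := map_coupledRV C hς hB hB_cont hς_cont
  rw [← hVu, AEMeasurable.map_map_of_aemeasurable (by rwa [hVu])
    (aemeasurable_coupledRV C hς hB hB_cont hς_cont)]
  rfl

theorem integralLE_mul_comp_coupledRV_iff (hς : Measurable ς) (hς_nonneg : 0 ≤ᵐ[P] ς)
    (hς_int : Integrable ς P) (hB : Measurable B) (hB_cont : Continuous (cdf (P.map B)))
    (hς_cont : ∀ᵐ ω ∂P, Continuous (cdf (condLawSDF P ς B (rankRV P B ω))))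
    {g : ℝ → ℝ} (hg : AEMeasurable g unif) (b : ℝ) :
    IntegralLE P (fun ω => ς ω * g (coupledRV P C ς B ω)) b ↔
      IntegralLE unif (fun u => g u * condSDF P C ς B u) b := by
  have hV := aemeasurable_coupledRV C hς hB hB_cont hς_cont
  have hVu := map_coupledRV C hς hB hB_cont hς_cont
  have key : ∀ h : ℝ → ℝ, AEMeasurable h unif →
      ∫⁻ ω, ENNReal.ofReal (ς ω * h (coupledRV P C ς B ω)) ∂P =
        ∫⁻ u, ENNReal.ofReal (h u * condSDF P C ς B u) ∂unif := by
    intro h hh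
    rw [lintegral_ofReal_mul_comp_eq hς hς_nonneg hς_int hV (by rwa [hVu]), hVu]
    rfl
  have hpos := key g hg
  have hneg := key (fun u => -g u) hg.neg
  simp only [mul_neg, neg_mul] at hneg
  rw [IntegralLE, IntegralLE, hpos, hneg]

theorem comp_coupledRV_mem_feasibleRV (hFT : FT ≤ mΩ) (hς : Measurable[FT] ς)
    (hς_nonneg : 0 ≤ᵐ[P] ς) (hς_int : Integrable ς P) (hB : Measurable[FT] B)
    (hB_sq : MemLp B 2 P) (hB_cont : Continuous (cdf (P.map B)))
    (hς_cont : ∀ᵐ ω ∂P, Continuous (cdf (condLawSDF P ς B (rankRV P B ω))))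
    {ε : ℝ} (hε : 0 ≤ ε) {g : ℝ → ℝ} (hg : g ∈ feasibleQ P C ς B ε) :
    (fun ω => g (coupledRV P C ς B ω)) ∈ feasibleRV FT P C ς B ε := by
  obtain ⟨hgq, hdist, hbudget⟩ := hg
  have hς' : Measurable ς := hς.mono hFT le_rfl
  have hB' : Measurable B := hB.mono hFT le_rfl
  have := Measure.isProbabilityMeasure_map (μ := P) hB'.aemeasurable
  have hgm : AEMeasurable g unif := hgq.2.2.1.aemeasurable
  have hV := aemeasurable_coupledRV C hς' hB' hB_cont hς_cont
  have hVu := map_coupledRV C hς' hB' hB_cont hς_cont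
  have hBq := quantile_mem_quantileFns ((memLp_map_measure_iff (by fun_prop) hB'.aemeasurable).2
    (show MemLp (id ∘ B) 2 P from hB_sq))
  refine ⟨?_, ?_, hasCopula_comp_coupledRV C hς' hB' hB_cont hς_cont hgq, ?_,
    (integralLE_mul_comp_coupledRV_iff hς' hς_nonneg hς_int hB' hB_cont hς_cont hgm _).2 hbudget⟩
  · have h := hgq.2.2
    rw [← hVu] at h
    exact (memLp_map_measure_iff h.1 hV).1 h
  · obtain ⟨q, hq, hVq⟩ := exists_measurable_coupledRV_ae_eq C hς' hB' hB_cont hς_cont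
    -- A Borel version of `g` composed with the Borel version of `V` in `(ς, B)` is a representative
    -- measurable at the horizon.
    refine ⟨fun ω => hgm.mk g (q (ς ω, B ω)), ?_, ?_⟩
    · exact (hgm.measurable_mk.comp (hq.comp (hς.prodMk hB))).stronglyMeasurable
    · have hmk : ∀ᵐ ω ∂P, g (coupledRV P C ς B ω) = hgm.mk g (coupledRV P C ς B ω) :=
        ae_of_ae_map hV (by rw [hVu]; exact hgm.ae_eq_mk)
      filter_upwards [hmk, hVq] with ω h1 h2
      rw [h1, h2]
  · rw [map_comp_coupledRV hς' hB' hB_cont hς_cont hgm, ← map_quantile (P.map B)]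
    exact wasserstein_le_of_integral_sq_sub_le hgq.2.2 hBq.2.2 hε hdist

/-- The distance constraint depends only on the law of `X`. For the budget, `X` is first replaced by
`F_X⁻¹(V)`, which is no more expensive. -/
theorem quantile_mem_feasibleQ (hς : Measurable ς) (hς_nonneg : 0 ≤ᵐ[P] ς)
    (hς_int : Integrable ς P) (hB : Measurable B)
    (hB_sq : MemLp B 2 P) (hB_cont : Continuous (cdf (P.map B)))
    (hς_cont : ∀ᵐ ω ∂P, Continuous (cdf (condLawSDF P ς B (rankRV P B ω))))
    {ε : ℝ} (hε : 0 ≤ ε) {X : Ω → ℝ} (hX : X ∈ feasibleRV FT P C ς B ε) :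
    quantile (P.map X) ∈ feasibleQ P C ς B ε := by
  obtain ⟨hX2, -, hXC, hdist, hbudget⟩ := hX
  have hXm := hX2.1.aemeasurable
  have := Measure.isProbabilityMeasure_map hXm
  have := Measure.isProbabilityMeasure_map (μ := P) hB.aemeasurable
  have hV := aemeasurable_coupledRV C hς hB hB_cont hς_cont
  have hVu := map_coupledRV C hς hB hB_cont hς_cont
  have hBq := quantile_mem_quantileFns ((memLp_map_measure_iff (by fun_prop) hB.aemeasurable).2
    (show MemLp (id ∘ B) 2 P from hB_sq))
  have hXq := quantile_mem_quantileFns ((memLp_map_measure_iff (by fun_prop) hXm).2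
    (show MemLp (id ∘ X) 2 P from hX2))
  have hqm := aemeasurable_quantile (P.map X)
  refine ⟨hXq, integral_sq_quantile_sub_le_of_wasserstein_le hXq.2.2 hBq.2.2 hε hdist,
    (integralLE_mul_comp_coupledRV_iff hς hς_nonneg hς_int hB hB_cont hς_cont hqm _).1 ?_⟩
  have hqm' : AEMeasurable (quantile (P.map X)) (P.map (coupledRV P C ς B)) := by rwa [hVu]
  exact integralLE_mul_of_withDensity_lt_le hς hς_nonneg hς_int hXm (hqm'.comp_aemeasurable hV)
    (withDensity_lt_le hς hB hB_cont hς_cont hX2 hXC) hbudget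

theorem riskRV_comp_coupledRV (hς : Measurable ς) (hB : Measurable B)
    (hB_cont : Continuous (cdf (P.map B)))
    (hς_cont : ∀ᵐ ω ∂P, Continuous (cdf (condLawSDF P ς B (rankRV P B ω))))
    {γ g : ℝ → ℝ} (hg : g ∈ quantileFns) :
    riskRV P γ (fun ω => g (coupledRV P C ς B ω)) = risk γ g := by
  rw [riskRV, map_comp_coupledRV hς hB hB_cont hς_cont hg.2.2.1.aemeasurable]
  exact risk_congr (quantile_map_ae_eq hg)

end

end Portfolio

theorem theorem2 {Ω : Type*} (FT : MeasurableSpace Ω) [mΩ : MeasurableSpace Ω] (hFT : FT ≤ mΩ)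
    (P : Measure Ω) [IsProbabilityMeasure P]
    -- the stochastic discount factor at the horizon
    (ς : Ω → ℝ) (hς : Measurable[FT] ς) (hς_nonneg : 0 ≤ᵐ[P] ς) (hς_int : Integrable ς P)
    -- the benchmark's terminal wealth
    (B : Ω → ℝ) (hB : Measurable[FT] B) (hB_sq : MemLp B 2 P)
    (hB_cont : Continuous (cdf (P.map B)))
    (hςB : Integrable (fun ω => ς ω * B ω) P)
    -- the conditional distribution function of the discount factor given `U = F(B)` is continuous
    (hς_cont : ∀ᵐ ω ∂P, Continuous (cdf (Portfolio.condLawSDF P ς B (Portfolio.rankRV P B ω))))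
    (C : Portfolio.Copula) (γ : ℝ → ℝ) (hγ : Portfolio.IsDistortionWeight γ)
    (ε : ℝ) (hε : 0 ≤ ε) :
    (∀ g ∈ Portfolio.feasibleQ P C ς B ε,
      IsMinOn (Portfolio.risk γ) (Portfolio.feasibleQ P C ς B ε) g →
        (fun ω => g (Portfolio.coupledRV P C ς B ω)) ∈ Portfolio.feasibleRV FT P C ς B ε ∧
        IsMinOn (Portfolio.riskRV P γ) (Portfolio.feasibleRV FT P C ς B ε)
          (fun ω => g (Portfolio.coupledRV P C ς B ω))) ∧
    (∀ X ∈ Portfolio.feasibleRV FT P C ς B ε,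
      IsMinOn (Portfolio.riskRV P γ) (Portfolio.feasibleRV FT P C ς B ε) X →
        Portfolio.quantile (P.map X) ∈ Portfolio.feasibleQ P C ς B ε ∧
        IsMinOn (Portfolio.risk γ) (Portfolio.feasibleQ P C ς B ε)
          (Portfolio.quantile (P.map X))) := by
  have hς' : Measurable ς := hς.mono hFT le_rfl
  have hB' : Measurable B := hB.mono hFT le_rfl
  have toRV : ∀ g ∈ Portfolio.feasibleQ P C ς B ε,
      (fun ω => g (Portfolio.coupledRV P C ς B ω)) ∈ Portfolio.feasibleRV FT P C ς B ε :=
    fun g hg => Portfolio.comp_coupledRV_mem_feasibleRV hFT hς hς_nonneg hς_int hB hB_sq hB_cont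
      hς_cont hε hg
  have toQ : ∀ X ∈ Portfolio.feasibleRV FT P C ς B ε,
      Portfolio.quantile (P.map X) ∈ Portfolio.feasibleQ P C ς B ε :=
    fun X hX => Portfolio.quantile_mem_feasibleQ hς' hς_nonneg hς_int hB' hB_sq hB_cont
      hς_cont hε hX
  have hrisk : ∀ g ∈ Portfolio.feasibleQ P C ς B ε,
      Portfolio.riskRV P γ (fun ω => g (Portfolio.coupledRV P C ς B ω)) = Portfolio.risk γ g :=
    fun g hg => Portfolio.riskRV_comp_coupledRV hς' hB' hB_cont hς_cont hg.1
  refine ⟨fun g hg hmin => ⟨toRV g hg, fun X hX => ?_⟩, fun X hX hmin => ⟨toQ X hX, fun g hg => ?_⟩⟩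
  · change Portfolio.riskRV P γ _ ≤ Portfolio.riskRV P γ X
    rw [hrisk g hg]
    -- `riskRV` at `X` is by definition `risk` at the quantile function of `X`.
    exact hmin (toQ X hX)
  · change Portfolio.riskRV P γ X ≤ Portfolio.risk γ g
    rw [← hrisk g hg]
    exact hmin (toRV g hg)
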